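/- Let $R$ be a commutative noetherian local ring with maximal ideal $\mathfrak m$ and residue field $k=R/\mathfrak m$. For $i\ge 0$ let $\mu^i(R)=\dim_k \operatorname{Ext}^i_R(k,R)$ denote the $i$-th Bass number of $R$ and, for a finitely generated $R$-module $M$, let $\beta_i(M)=\dim_k\operatorname{Ext}^i_R(M,k)$ denote its $i$-th Betti number. Write $\ell$ for the length of an $R$-module. (a) If $R$ is Cohen–Macaulay and $\mu^n(R)=1$ for some $n\ge 0$, then $R$ is Gorenstein of Krull dimension $n$. (b) Suppose that $R$ is artinian, and let $M$ be a finitely generated $R$-module that is not free. If $\ell(R)$ divides $\ell(M)$, then $\beta_i(M)\ge 2$ for all $i\ge 0$. If moreover $\ell(M)=\ell(R)$, then $\beta_1(M)\ge\beta_0(M)$. -/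

import Mathlib

universe u

open CategoryTheory

namespace LocalAlgebra

section Ext

variable (R : Type u) [CommRing R] [IsLocalRing R]

/-- The residue field `k = R ⧸ m` as an object of the category of `R`-modules. -/
noncomputable abbrev residueModule : ModuleCat.{u} R :=
  ModuleCat.of R (IsLocalRing.ResidueField R)

variable {R}

theorem smul_id_residueModule_eq_zero {r : R} (hr : r ∈ IsLocalRing.maximalIdeal R) :
    r • 𝟙 (residueModule R) = 0 := by
  ext x
  change r • x = 0
  rw [Algebra.smul_def, IsLocalRing.ResidueField.algebraMap_eq,
    (IsLocalRing.residue_eq_zero_iff r).mpr hr, zero_mul]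

/-- The maximal ideal annihilates `Ext^i(k, N)`. -/
theorem isTorsionBySet_ext_residue_left (N : ModuleCat.{u} R) (i : ℕ) :
    Module.IsTorsionBySet R (Abelian.Ext (residueModule R) N i)
      (IsLocalRing.maximalIdeal R : Set R) := by
  rintro x ⟨r, hr⟩
  have h : r • x = (Abelian.Ext.mk₀ (r • 𝟙 (residueModule R))).comp x (zero_add i) := by
    simp [Abelian.Ext.mk₀_smul]
  change r • x = 0
  rw [h, smul_id_residueModule_eq_zero hr, Abelian.Ext.mk₀_zero, Abelian.Ext.zero_comp]

/-- The maximal ideal annihilates `Ext^i(M, k)`. -/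
theorem isTorsionBySet_ext_residue_right (M : ModuleCat.{u} R) (i : ℕ) :
    Module.IsTorsionBySet R (Abelian.Ext M (residueModule R) i)
      (IsLocalRing.maximalIdeal R : Set R) := by
  rintro x ⟨r, hr⟩
  have h : r • x = x.comp (Abelian.Ext.mk₀ (r • 𝟙 (residueModule R))) (add_zero i) := by
    simp [Abelian.Ext.mk₀_smul]
  change r • x = 0
  rw [h, smul_id_residueModule_eq_zero hr, Abelian.Ext.mk₀_zero, Abelian.Ext.comp_zero]

/-- The `k`-vector space structure on `Ext^i(k, N)` induced by its `R`-module structure. -/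
noncomputable abbrev residueFieldModuleExtLeft (N : ModuleCat.{u} R) (i : ℕ) :
    Module (IsLocalRing.ResidueField R) (Abelian.Ext (residueModule R) N i) :=
  (isTorsionBySet_ext_residue_left N i).module

/-- The `k`-vector space structure on `Ext^i(M, k)` induced by its `R`-module structure. -/
noncomputable abbrev residueFieldModuleExtRight (M : ModuleCat.{u} R) (i : ℕ) :
    Module (IsLocalRing.ResidueField R) (Abelian.Ext M (residueModule R) i) :=
  (isTorsionBySet_ext_residue_right M i).module

end Ext

/-- The `i`-th Bass number `μ^i(R) = dim_k Ext^i_R(k, R)` of a local ring. -/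
noncomputable def bassNumber (R : Type u) [CommRing R] [IsLocalRing R] (i : ℕ) : ℕ :=
  letI := residueFieldModuleExtLeft (ModuleCat.of R R) i
  Module.finrank (IsLocalRing.ResidueField R)
    (Abelian.Ext (residueModule R) (ModuleCat.of R R) i)

/-- The `i`-th Betti number `β_i(M) = dim_k Ext^i_R(M, k)` of a module over a local ring. -/
noncomputable def bettiNumber (R : Type u) [CommRing R] [IsLocalRing R]
    (M : Type u) [AddCommGroup M] [Module R M] (i : ℕ) : ℕ :=
  letI := residueFieldModuleExtRight (ModuleCat.of R M) i
  Module.finrank (IsLocalRing.ResidueField R)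
    (Abelian.Ext (ModuleCat.of R M) (residueModule R) i)

/-- The depth of a local ring: the supremum of the lengths of the `R`-regular sequences
contained in the maximal ideal. -/
noncomputable def depth (R : Type u) [CommRing R] [IsLocalRing R] : ℕ∞ :=
  ⨆ (rs : List R) (_ : (∀ r ∈ rs, r ∈ IsLocalRing.maximalIdeal R) ∧
    RingTheory.Sequence.IsRegular R rs), (rs.length : ℕ∞)

/-- A noetherian local ring is Cohen–Macaulay if its depth equals its Krull dimension. -/
def IsCohenMacaulay (R : Type u) [CommRing R] [IsNoetherianRing R] [IsLocalRing R] : Prop :=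
  (depth R : WithBot ℕ∞) = ringKrullDim R

/-- A noetherian local ring is Gorenstein if it has finite injective dimension as a module
over itself. -/
def IsGorenstein (R : Type u) [CommRing R] [IsNoetherianRing R] [IsLocalRing R] : Prop :=
  ∃ n : ℕ, HasInjectiveDimensionLE (ModuleCat.of R R) n

end LocalAlgebra

/-! All numbers are read as lengths of `Ext` over `R`.

Artinian case, Betti numbers. A minimal cover `R^b → M` has `b = β₀(M)` and kernel inside `𝔪R^b`.
Its kernel shifts Betti numbers down by one, and its length is `b·ℓ(R) - ℓ(M)`, so divisibility by
`ℓ(R)` passes to syzygies. If `β_n(M) ≤ 1`, the `n`-th syzygy is cyclic of length divisible by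
`ℓ(R)`, hence zero or `R`, hence free. A free module inside `𝔪R^b` is zero, because a socle element
of `R` kills it; so freeness climbs back up to `M` (`free_of_length_ext_residue_le_one`). The
inequality `β₀ ≤ β₁` is a length count over two such covers.

Artinian case, Bass numbers. The argument dualizes with the injective hull `E` of `k` in place of
`R`: modules embed in `E^b` with image containing the socle, and `ℓ(E) = ℓ(R)`. Thus `μ^n(R) = 1`
makes `R` self-injective, which forces `n = 0` (`injective_self_of_length_ext_eq_one`).

Cohen–Macaulay case. Induction along a maximal regular sequence. Rees' isomorphism `Ext^n(N, R/x) ≅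
Ext^(n+1)(N, R)` (`reesMap_bijective`) moves the hypothesis to `R/x` with `n` lowered by one. Finite
injective dimension returns from `R/x` to `R` by Nakayama and prime filtrations
(`hasInjectiveDimensionLE_succ_of_quotient`). -/

namespace LocalAlgebra

/-! ### Length under change of rings; Bass and Betti numbers as lengths -/

section Length

/-- Such a map identifies the submodule lattices, whose Krull dimension is the length. Semilinearity
allows comparison over `R`, `k` and `R ⧸ (x)`. -/
theorem length_eq_of_bijective {A B M N : Type*} [Ring A] [Ring B] [AddCommGroup M]
    [AddCommGroup N] [Module A M] [Module B N] {σ : A →+* B} [RingHomSurjective σ]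
    (f : M →ₛₗ[σ] N) (hf : Function.Bijective f) : Module.length A M = Module.length B N := by
  rw [Module.length, Module.length, WithBot.unbot_inj,
    Order.krullDim_eq_of_orderIso (Submodule.orderIsoMapComapOfBijective f hf)]

theorem length_eq_of_torsionBySet {R V : Type*} [CommRing R] (I : Ideal R) [AddCommGroup V]
    [Module R V] (h : Module.IsTorsionBySet R V (I : Set R)) :
    letI : Module (R ⧸ I) V := h.module
    Module.length R V = Module.length (R ⧸ I) V := by
  let : Module (R ⧸ I) V := h.module
  let f : V →ₛₗ[Ideal.Quotient.mk I] V :=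
    { toFun := id, map_add' := fun _ _ => rfl, map_smul' := fun _ _ => rfl }
  have : RingHomSurjective (Ideal.Quotient.mk I) := ⟨Ideal.Quotient.mk_surjective⟩
  exact length_eq_of_bijective f Function.bijective_id

end Length

section Numbers

variable {R : Type u} [CommRing R] [IsLocalRing R]

theorem length_ext_eq_one_of_bassNumber_eq_one {n : ℕ} (h : bassNumber R n = 1) :
    Module.length R (Abelian.Ext (residueModule R) (ModuleCat.of R R) n) = 1 := by
  let := residueFieldModuleExtLeft (ModuleCat.of R R) n
  have h' : Module.finrank (IsLocalRing.ResidueField R)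
    (Abelian.Ext (residueModule R) (ModuleCat.of R R) n) = 1 := h
  have : Module.Finite (IsLocalRing.ResidueField R)
      (Abelian.Ext (residueModule R) (ModuleCat.of R R) n) :=
    Module.finite_of_finrank_pos (by omega)
  have e := length_eq_of_torsionBySet (IsLocalRing.maximalIdeal R)
    (isTorsionBySet_ext_residue_left (ModuleCat.of R R) n)
  refine e.trans ?_
  refine (Module.length_eq_finrank (IsLocalRing.ResidueField R)
    (Abelian.Ext (residueModule R) (ModuleCat.of R R) n)).trans ?_
  rw [h']; rfl

/-- Finite length over `R` excludes the default value `0` that `Module.finrank` takes on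
infinite-dimensional spaces. -/
theorem bettiNumber_eq_of_length_ext_eq {M : Type u} [AddCommGroup M] [Module R M] {n b : ℕ}
    (h : Module.length R (Abelian.Ext (ModuleCat.of R M) (residueModule R) n) = b) :
    bettiNumber R M n = b := by
  let := residueFieldModuleExtRight (ModuleCat.of R M) n
  have e : Module.length R (Abelian.Ext (ModuleCat.of R M) (residueModule R) n) =
      Module.length (IsLocalRing.ResidueField R)
        (Abelian.Ext (ModuleCat.of R M) (residueModule R) n) :=
    length_eq_of_torsionBySet (IsLocalRing.maximalIdeal R)
      (isTorsionBySet_ext_residue_right (ModuleCat.of R M) n)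
  rw [h] at e
  have : IsFiniteLength (IsLocalRing.ResidueField R)
      (Abelian.Ext (ModuleCat.of R M) (residueModule R) n) :=
    Module.length_ne_top_iff.mp (by rw [← e]; exact ENat.natCast_ne_top b)
  have : IsNoetherian (IsLocalRing.ResidueField R)
      (Abelian.Ext (ModuleCat.of R M) (residueModule R) n) :=
    (isFiniteLength_iff_isNoetherian_isArtinian.mp this).1
  rw [Module.length_eq_finrank] at e
  exact (by exact_mod_cast e.symm : Module.finrank (IsLocalRing.ResidueField R)
    (Abelian.Ext (ModuleCat.of R M) (residueModule R) n) = b)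

end Numbers

/-! ### Dimension shifting for Ext -/

section DimensionShift

variable {R : Type u} [CommRing R]

/-- Ext out of a projective vanishes in positive degrees, so the connecting map is bijective; `h`
supplies injectivity when `n = 0`. -/
theorem length_ext_succ_eq_of_projective {S : ShortComplex (ModuleCat.{u} R)} (hS : S.ShortExact)
    [Projective S.X₂] (Y : ModuleCat.{u} R) (h : ∀ g : S.X₂ ⟶ Y, S.f ≫ g = 0) (n : ℕ) :
    Module.length R (Abelian.Ext S.X₃ Y (n + 1)) = Module.length R (Abelian.Ext S.X₁ Y n) := by
  symm
  refine length_eq_of_bijective (σ := RingHom.id R)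
    (Abelian.Ext.bilinearCompOfLinear R S.X₃ S.X₁ Y 1 n (n + 1) (add_comm 1 n) hS.extClass)
    ⟨?_, fun x => ?_⟩
  · rw [injective_iff_map_eq_zero]
    intro x hx
    obtain ⟨y, rfl⟩ := Abelian.Ext.contravariant_sequence_exact₁ hS Y x (add_comm 1 n) hx
    cases n with
    | zero =>
      obtain ⟨g, rfl⟩ := (Abelian.Ext.mk₀_bijective _ _).2 y
      rw [Abelian.Ext.mk₀_comp_mk₀, h, Abelian.Ext.mk₀_zero]
    | succ n => rw [Abelian.Ext.eq_zero_of_projective y, Abelian.Ext.comp_zero]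
  · exact Abelian.Ext.contravariant_sequence_exact₃ hS Y x
      (Abelian.Ext.eq_zero_of_projective _) (add_comm 1 n)

theorem length_ext_succ_eq_of_injective {S : ShortComplex (ModuleCat.{u} R)} (hS : S.ShortExact)
    [Injective S.X₂] (Y : ModuleCat.{u} R) (h : ∀ g : Y ⟶ S.X₂, g ≫ S.g = 0) (n : ℕ) :
    Module.length R (Abelian.Ext Y S.X₁ (n + 1)) = Module.length R (Abelian.Ext Y S.X₃ n) := by
  symm
  refine length_eq_of_bijective (σ := RingHom.id R)
    ((Abelian.Ext.bilinearCompOfLinear R Y S.X₃ S.X₁ n 1 (n + 1) rfl).flip hS.extClass)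
    ⟨?_, fun x => ?_⟩
  · rw [injective_iff_map_eq_zero]
    intro x hx
    obtain ⟨y, rfl⟩ := Abelian.Ext.covariant_sequence_exact₃ Y hS x rfl hx
    cases n with
    | zero =>
      obtain ⟨g, rfl⟩ := (Abelian.Ext.mk₀_bijective _ _).2 y
      rw [Abelian.Ext.mk₀_comp_mk₀, h, Abelian.Ext.mk₀_zero]
    | succ n => rw [Abelian.Ext.eq_zero_of_injective y, Abelian.Ext.zero_comp]
  · exact Abelian.Ext.covariant_sequence_exact₁ Y hS x (Abelian.Ext.eq_zero_of_injective _) rfl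

theorem length_ext_zero_eq_length_linearMap (X Y : ModuleCat.{u} R) :
    Module.length R (Abelian.Ext X Y 0) = Module.length R (X →ₗ[R] Y) :=
  LinearEquiv.length_eq (Abelian.Ext.linearEquiv₀.trans ModuleCat.homLinearEquiv)

end DimensionShift

section ENat

theorem enat_dvd_iff {d a : ℕ} (hd : d ≠ 0) : (d : ℕ∞) ∣ (a : ℕ∞) ↔ d ∣ a := by
  constructor
  · rintro ⟨c, hc⟩
    induction c using ENat.recTopCoe with
    | top => rw [ENat.mul_top (by exact_mod_cast hd)] at hc; exact absurd hc (ENat.natCast_ne_top a)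
    | coe c => exact ⟨c, by exact_mod_cast hc⟩
  · rintro ⟨c, rfl⟩
    exact ⟨c, by push_cast; rfl⟩

/-- Passes divisibility by `ℓ(R)` from a module to its syzygy or cosyzygy. -/
theorem enat_dvd_of_add_eq_mul {d a b : ℕ∞} {n : ℕ} (hd : d ≠ 0) (hd' : d ≠ ⊤)
    (h : a + b = n * d) (hb : d ∣ b) : d ∣ a := by
  lift d to ℕ using hd'
  have hab : a + b ≠ ⊤ := by rw [h]; exact_mod_cast ENat.natCast_ne_top (n * d)
  obtain ⟨ha', hb'⟩ : a ≠ ⊤ ∧ b ≠ ⊤ := by simpa using hab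
  lift a to ℕ using ha'
  lift b to ℕ using hb'
  have hd : d ≠ 0 := by exact_mod_cast hd
  rw [enat_dvd_iff hd] at hb ⊢
  have h : a + b = n * d := by exact_mod_cast h
  exact (Nat.dvd_add_left hb).mp (h ▸ Dvd.intro_left n rfl)

end ENat

/-! ### Residue field and socle -/

section ResidueField

variable (R : Type u) [CommRing R] [IsLocalRing R]

theorem isSimpleModule_residueField : IsSimpleModule R (IsLocalRing.ResidueField R) :=
  isSimpleModule_iff_quot_maximal.mpr
    ⟨IsLocalRing.maximalIdeal R, inferInstance, ⟨LinearEquiv.refl R _⟩⟩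

theorem length_residueField : Module.length R (IsLocalRing.ResidueField R) = 1 :=
  Module.length_eq_one_iff.mpr (isSimpleModule_residueField R)

variable {R}

theorem smul_residueField_eq_zero {r : R} (hr : r ∈ IsLocalRing.maximalIdeal R)
    (x : IsLocalRing.ResidueField R) : r • x = 0 := by
  rw [Algebra.smul_def, IsLocalRing.ResidueField.algebraMap_eq,
    (IsLocalRing.residue_eq_zero_iff r).mpr hr, zero_mul]

theorem map_pi_residueField_eq_zero {b : ℕ} (g : (Fin b → R) →ₗ[R] IsLocalRing.ResidueField R)
    {x : Fin b → R} (hx : ∀ i, x i ∈ IsLocalRing.maximalIdeal R) : g x = 0 := by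
  rw [pi_eq_sum_univ' x, map_sum]
  refine Finset.sum_eq_zero fun i _ => ?_
  rw [map_smul]
  exact smul_residueField_eq_zero (hx i) _

theorem length_linearMap_pi_residueField (b : ℕ) :
    Module.length R ((Fin b → R) →ₗ[R] IsLocalRing.ResidueField R) = b := by
  rw [← ((Pi.basisFun R (Fin b)).constr R (M' := IsLocalRing.ResidueField R)).length_eq,
    Module.length_pi_of_fintype]
  simp [length_residueField]

end ResidueField

section Socle

variable {R : Type u} [CommRing R] [IsArtinianRing R] [IsLocalRing R]

theorem exists_ne_zero_smul_eq_zero (N : Type*) [AddCommGroup N] [Module R N] [Nontrivial N] :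
    ∃ x : N, x ≠ 0 ∧ ∀ r ∈ IsLocalRing.maximalIdeal R, r • x = 0 := by
  obtain ⟨p, hp⟩ := associatedPrimes.nonempty R N
  obtain ⟨hp, x, rfl⟩ := isAssociatedPrime_iff.mp hp
  have hm := IsLocalRing.eq_maximalIdeal (IsArtinianRing.isMaximal_of_isPrime
    (Submodule.colon (⊥ : Submodule R N) {x}))
  refine ⟨x, ?_, fun r hr => ?_⟩
  · rintro rfl
    exact hp.ne_top (by ext; simp [Submodule.mem_colon_singleton])
  · rw [← hm, Submodule.mem_colon_singleton] at hr
    exact hr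

omit [IsLocalRing R] in
theorem length_self_ne_top : Module.length R R ≠ ⊤ := Module.length_ne_top

omit [IsArtinianRing R] in
theorem length_self_ne_zero : Module.length R R ≠ 0 := Module.length_pos.ne'

end Socle

/-! ### Minimal free covers and Betti numbers -/

section MinimalCover

variable {R : Type u} [CommRing R] [IsLocalRing R]

-- Lift a basis of `k ⊗ M`: Nakayama gives surjectivity, and linear independence over `k` puts the
-- coefficients of every relation in `𝔪`.
open TensorProduct in
theorem exists_minimal_cover (M : Type*) [AddCommGroup M] [Module R M] [Module.Finite R M] :
    ∃ (b : ℕ) (f : (Fin b → R) →ₗ[R] M), Function.Surjective f ∧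
      ∀ x, f x = 0 → ∀ i, x i ∈ IsLocalRing.maximalIdeal R := by
  let B := Module.finBasis (IsLocalRing.ResidueField R) (IsLocalRing.ResidueField R ⊗[R] M)
  obtain ⟨v, hv⟩ := (TensorProduct.mk_surjective R M (IsLocalRing.ResidueField R)
    Ideal.Quotient.mk_surjective).comp_left B
  have hv' : ∀ i, (1 : IsLocalRing.ResidueField R) ⊗ₜ[R] v i = B i := fun i => congrFun hv i
  refine ⟨_, Fintype.linearCombination R v, ?_, fun x hx i => ?_⟩
  · rw [← LinearMap.range_eq_top, Fintype.range_linearCombination]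
    exact IsLocalRing.span_eq_top_of_tmul_eq_basis v B hv'
  · have h : ∑ j, IsLocalRing.residue R (x j) • B j = 0 := by
      rw [Fintype.linearCombination_apply] at hx
      calc ∑ j, IsLocalRing.residue R (x j) • B j
          = (1 : IsLocalRing.ResidueField R) ⊗ₜ[R] ∑ j, x j • v j := by
            rw [TensorProduct.tmul_sum]
            refine Finset.sum_congr rfl fun j _ => ?_
            rw [TensorProduct.tmul_smul, hv' j]
            exact algebraMap_smul (IsLocalRing.ResidueField R) (x j) (B j)
        _ = 0 := by rw [hx, TensorProduct.tmul_zero]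
    exact (IsLocalRing.residue_eq_zero_iff _).mp
      (Fintype.linearIndependent_iff.mp B.linearIndependent _ h i)

variable {M : Type u} [AddCommGroup M] [Module R M] {b : ℕ} {f : (Fin b → R) →ₗ[R] M}

/-- Every map `R^b → k` kills `𝔪R^b`, hence `ker f`, and so factors through `M`. -/
theorem length_ext_zero_of_minimal_cover (hf : Function.Surjective f)
    (hf' : ∀ x, f x = 0 → ∀ i, x i ∈ IsLocalRing.maximalIdeal R) :
    Module.length R (Abelian.Ext (ModuleCat.of R M) (residueModule R) 0) = b := by
  rw [length_ext_zero_eq_length_linearMap, ← length_linearMap_pi_residueField (R := R) b]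
  refine length_eq_of_bijective (LinearMap.lcomp R (IsLocalRing.ResidueField R) f)
    ⟨fun g g' h => ?_, fun g => ?_⟩
  · exact (LinearMap.cancel_right hf).mp h
  · have hg : LinearMap.ker f ≤ LinearMap.ker g := fun x hx =>
      map_pi_residueField_eq_zero g (hf' x hx)
    refine ⟨(LinearMap.ker f).liftQ g hg ∘ₗ (f.quotKerEquivOfSurjective hf).symm.toLinearMap, ?_⟩
    ext1 x
    ext
    simp only [LinearMap.lcomp_apply', LinearMap.coe_comp, Function.comp_apply]
    generalize (LinearMap.single R (fun _ => R) x) (1 : R) = y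
    change (LinearMap.ker f).liftQ g hg ((f.quotKerEquivOfSurjective hf).symm (f y)) = g y
    have : f y = f.quotKerEquivOfSurjective hf (Submodule.Quotient.mk y) := rfl
    rw [this, LinearEquiv.symm_apply_apply]
    rfl

theorem length_ext_succ_of_minimal_cover (hf : Function.Surjective f)
    (hf' : ∀ x, f x = 0 → ∀ i, x i ∈ IsLocalRing.maximalIdeal R) (n : ℕ) :
    Module.length R (Abelian.Ext (ModuleCat.of R M) (residueModule R) (n + 1)) =
      Module.length R
        (Abelian.Ext (ModuleCat.of R (LinearMap.ker f)) (residueModule R) n) := by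
  have : Projective f.shortComplexKer.X₂ :=
    inferInstanceAs (Projective (ModuleCat.of R (Fin b → R)))
  refine length_ext_succ_eq_of_projective (LinearMap.shortExact_shortComplexKer hf) _
    (fun g => ?_) n
  ext x
  exact map_pi_residueField_eq_zero g.hom (hf' _ x.2)

omit [IsLocalRing R] in
theorem length_ker_add_length_of_surjective (hf : Function.Surjective f) :
    Module.length R (LinearMap.ker f) + Module.length R M = b * Module.length R R := by
  rw [← Module.length_eq_add_of_exact (LinearMap.ker f).subtype f (Submodule.subtype_injective _) hf
    (LinearMap.exact_subtype_ker_map f), Module.length_pi_of_fintype]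
  simp

end MinimalCover

section Artinian

variable {R : Type u} [CommRing R] [IsArtinianRing R] [IsLocalRing R]

/-- A nonzero socle element of `R` kills `𝔪R^b`, hence the kernel, but it cannot kill a basis
vector. -/
theorem subsingleton_ker_of_free {M : Type*} [AddCommGroup M] [Module R M] {b : ℕ}
    {f : (Fin b → R) →ₗ[R] M} (hf' : ∀ x, f x = 0 → ∀ i, x i ∈ IsLocalRing.maximalIdeal R)
    [Module.Free R (LinearMap.ker f)] : Subsingleton (LinearMap.ker f) := by
  obtain ⟨s, hs, hs'⟩ := exists_ne_zero_smul_eq_zero (R := R) R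
  by_contra h
  rw [not_subsingleton_iff_nontrivial] at h
  obtain ⟨i⟩ := (Module.Free.chooseBasis R (LinearMap.ker f)).index_nonempty
  have h0 : s • Module.Free.chooseBasis R (LinearMap.ker f) i = 0 := by
    ext j
    have := hs' _ (hf' _ (Module.Free.chooseBasis R (LinearMap.ker f) i).2 j)
    rw [smul_eq_mul, mul_comm] at this
    exact this
  have := congrArg (fun x => (Module.Free.chooseBasis R (LinearMap.ker f)).repr x i) h0
  simp at this
  exact hs this

omit [IsArtinianRing R] [IsLocalRing R] in
theorem free_of_subsingleton_ker {M : Type*} [AddCommGroup M] [Module R M] {b : ℕ}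
    {f : (Fin b → R) →ₗ[R] M} (hf : Function.Surjective f) [h : Subsingleton (LinearMap.ker f)] :
    Module.Free R M :=
  Module.Free.of_equiv (LinearEquiv.ofBijective f
    ⟨LinearMap.ker_eq_bot.mp ((Submodule.subsingleton_iff_eq_bot).mp h), hf⟩)

theorem length_ext_residue_ne_top (M : Type u) [AddCommGroup M] [Module R M] [Module.Finite R M]
    (n : ℕ) : ∃ b : ℕ,
    Module.length R (Abelian.Ext (ModuleCat.of R M) (residueModule R) n) = b := by
  induction n generalizing M with
  | zero =>
    obtain ⟨b, f, hf, hf'⟩ := exists_minimal_cover (R := R) M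
    exact ⟨b, length_ext_zero_of_minimal_cover hf hf'⟩
  | succ n ih =>
    obtain ⟨b, f, hf, hf'⟩ := exists_minimal_cover (R := R) M
    rw [length_ext_succ_of_minimal_cover hf hf']
    exact ih _

theorem free_of_length_ext_residue_le_one (M : Type u) [AddCommGroup M] [Module R M]
    [Module.Finite R M] (hM : Module.length R R ∣ Module.length R M) (n : ℕ)
    (hn : Module.length R (Abelian.Ext (ModuleCat.of R M) (residueModule R) n) ≤ 1) :
    Module.Free R M := by
  obtain ⟨b, f, hf, hf'⟩ := exists_minimal_cover (R := R) M
  have hl := length_ker_add_length_of_surjective hf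
  suffices Subsingleton (LinearMap.ker f) from free_of_subsingleton_ker hf
  induction n generalizing M b with
  | zero =>
    rw [length_ext_zero_of_minimal_cover hf hf'] at hn
    have hb : b ≤ 1 := by exact_mod_cast hn
    obtain ⟨c, hc⟩ := hM
    rw [← Module.length_eq_zero_iff (R := R)]
    rcases Nat.le_one_iff_eq_zero_or_eq_one.mp hb with rfl | rfl
    · simp
    · by_cases h0 : c = 0
      · subst h0
        rw [mul_zero, Module.length_eq_zero_iff] at hc
        -- Here `M = 0`, so the kernel is all of `R` and minimality would put `1` in `𝔪`.
        have h1 := hf' 1 (Subsingleton.elim _ _) 0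
        exact absurd h1 (by simp)
      · have h1 : Module.length R R ≤ Module.length R M := by
          rw [hc]; exact le_mul_of_one_le_right' (Order.one_le_iff_ne_zero.mpr h0)
        have h2 : Module.length R (LinearMap.ker f) + Module.length R R ≤ 0 + Module.length R R := by
          calc _ ≤ Module.length R (LinearMap.ker f) + Module.length R M := by gcongr
            _ = _ := by rw [hl]; simp
        exact le_antisymm ((ENat.add_le_add_iff_right length_self_ne_top).mp h2) bot_le
  | succ n ih =>
    rw [length_ext_succ_of_minimal_cover hf hf'] at hn
    have hd := enat_dvd_of_add_eq_mul length_self_ne_zero length_self_ne_top hl hM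
    obtain ⟨b', f', hf₁, hf₂⟩ := exists_minimal_cover (R := R) (LinearMap.ker f)
    have := ih _ hd hn b' f' hf₁ hf₂ (length_ker_add_length_of_surjective hf₁)
    have := free_of_subsingleton_ker hf₁
    exact subsingleton_ker_of_free hf'

theorem two_le_bettiNumber (M : Type u) [AddCommGroup M] [Module R M]
    [Module.Finite R M] (hfree : ¬ Module.Free R M)
    (hM : Module.length R R ∣ Module.length R M) (n : ℕ) : 2 ≤ bettiNumber R M n := by
  obtain ⟨b, hb⟩ := length_ext_residue_ne_top (R := R) M n
  rw [bettiNumber_eq_of_length_ext_eq hb]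
  by_contra h
  exact hfree (free_of_length_ext_residue_le_one M hM n (by rw [hb]; exact_mod_cast (by omega)))

theorem bettiNumber_zero_le_bettiNumber_one (M : Type u) [AddCommGroup M] [Module R M]
    [Module.Finite R M] (hfree : ¬ Module.Free R M)
    (hM : Module.length R M = Module.length R R) : bettiNumber R M 0 ≤ bettiNumber R M 1 := by
  obtain ⟨b, f, hf, hf'⟩ := exists_minimal_cover (R := R) M
  obtain ⟨c, g, hg, hg'⟩ := exists_minimal_cover (R := R) (LinearMap.ker f)
  rw [bettiNumber_eq_of_length_ext_eq (length_ext_zero_of_minimal_cover hf hf'),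
    bettiNumber_eq_of_length_ext_eq ((length_ext_succ_of_minimal_cover hf hf' 0).trans
      (length_ext_zero_of_minimal_cover hg hg'))]
  by_contra! hlt
  refine hfree ?_
  suffices Module.length R (LinearMap.ker g) = 0 by
    rw [Module.length_eq_zero_iff] at this
    have := free_of_subsingleton_ker hg
    have := subsingleton_ker_of_free hf'
    exact free_of_subsingleton_ker hf
  have h1 := length_ker_add_length_of_surjective hf
  have h2 := length_ker_add_length_of_surjective hg
  rw [hM] at h1
  have e1 : Module.length R (LinearMap.ker f) ≠ ⊤ := Module.length_ne_top
  have e2 : Module.length R (LinearMap.ker g) ≠ ⊤ := Module.length_ne_top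
  have e3 : Module.length R R ≠ ⊤ := length_self_ne_top
  have e4 : Module.length R R ≠ 0 := length_self_ne_zero
  lift Module.length R (LinearMap.ker f) to ℕ using e1 with x
  lift Module.length R (LinearMap.ker g) to ℕ using e2 with y
  lift Module.length R R to ℕ using e3 with l
  norm_cast at *
  -- With `x + l = b * l` and `y + x = c * l`, the inequality `c < b` leaves no room for `y > 0`.
  have : (c + 1) * l ≤ b * l := Nat.mul_le_mul_right l hlt
  rw [add_mul] at this
  omega

end Artinian

/-! ### Maps out of the residue field -/

section ResidueFieldMaps

variable {R : Type u} [CommRing R] [IsLocalRing R]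

theorem exists_linearMap_residueField {N : Type*} [AddCommGroup N] [Module R N] {x : N}
    (hx : ∀ r ∈ IsLocalRing.maximalIdeal R, r • x = 0) :
    ∃ g : IsLocalRing.ResidueField R →ₗ[R] N, g 1 = x :=
  ⟨(IsLocalRing.maximalIdeal R).liftQ (LinearMap.toSpanSingleton R N x) fun r hr => hx r hr, by
    change LinearMap.toSpanSingleton R N x 1 = x
    simp⟩

theorem injective_of_map_one_ne_zero {N : Type*} [AddCommGroup N] [Module R N]
    {g : IsLocalRing.ResidueField R →ₗ[R] N} (hg : g 1 ≠ 0) : Function.Injective g := by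
  have := isSimpleModule_residueField R
  refine (LinearMap.injective_or_eq_zero g).resolve_right ?_
  rintro rfl
  exact hg rfl

theorem linearMap_residueField_ext {N : Type*} [AddCommGroup N] [Module R N]
    {g h : IsLocalRing.ResidueField R →ₗ[R] N} (H : g 1 = h 1) : g = h := by
  ext x
  obtain ⟨r, rfl⟩ := IsLocalRing.residue_surjective x
  have : IsLocalRing.residue R r = r • (1 : IsLocalRing.ResidueField R) := by
    rw [Algebra.smul_def, mul_one]; rfl
  rw [this, map_smul, map_smul, H]

theorem smul_map_residueField_eq_zero {N : Type*} [AddCommGroup N] [Module R N]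
    (g : IsLocalRing.ResidueField R →ₗ[R] N) {r : R} (hr : r ∈ IsLocalRing.maximalIdeal R)
    (x : IsLocalRing.ResidueField R) : r • g x = 0 := by
  rw [← map_smul, smul_residueField_eq_zero hr, map_zero]

/-- A map out of `k` is an element killed by `𝔪`, so only the socle of `N` matters. -/
theorem length_residueField_linearMap_eq {M N : Type*} [AddCommGroup M] [Module R M]
    [AddCommGroup N] [Module R N] (f : M →ₗ[R] N) (hf : Function.Injective f)
    (h : ∀ x : N, (∀ r ∈ IsLocalRing.maximalIdeal R, r • x = 0) → x ∈ LinearMap.range f) :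
    Module.length R (IsLocalRing.ResidueField R →ₗ[R] M) =
      Module.length R (IsLocalRing.ResidueField R →ₗ[R] N) := by
  refine length_eq_of_bijective (f.compRight R) ⟨fun g g' hg => ?_, fun g => ?_⟩
  · exact (LinearMap.cancel_left hf).mp hg
  · obtain ⟨y, hy⟩ := h (g 1) fun r hr => smul_map_residueField_eq_zero g hr 1
    obtain ⟨g', hg'⟩ := exists_linearMap_residueField (x := y) fun r hr => hf (by
      rw [map_smul, hy, smul_map_residueField_eq_zero g hr, map_zero])
    exact ⟨g', linearMap_residueField_ext (by rw [LinearMap.compRight_apply,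
      LinearMap.comp_apply, hg', hy])⟩

theorem length_residueField_linearMap_residueField :
    Module.length R (IsLocalRing.ResidueField R →ₗ[R] IsLocalRing.ResidueField R) = 1 := by
  rw [← length_residueField R]
  refine length_eq_of_bijective (LinearMap.applyₗ (R := R) (1 : IsLocalRing.ResidueField R))
    ⟨fun g g' h => linearMap_residueField_ext h, fun x => ?_⟩
  obtain ⟨g, hg⟩ := exists_linearMap_residueField (x := x)
    fun r hr => smul_residueField_eq_zero hr x
  exact ⟨g, hg⟩

theorem length_residueField_linearMap_pi (b : ℕ) (N : Type*) [AddCommGroup N] [Module R N] :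
    Module.length R (IsLocalRing.ResidueField R →ₗ[R] Fin b → N) =
      b * Module.length R (IsLocalRing.ResidueField R →ₗ[R] N) := by
  rw [length_eq_of_bijective (LinearMap.pi fun i : Fin b =>
    (LinearMap.proj (R := R) (φ := fun _ : Fin b => N) i).compRight R
      (M := IsLocalRing.ResidueField R)) ⟨fun g g' h => ?_, fun g => ⟨LinearMap.pi g, rfl⟩⟩,
    Module.length_pi_of_fintype]
  · simp
  · ext x i
    exact LinearMap.congr_fun (congrFun h i) x

end ResidueFieldMaps

/-! ### The injective hull of the residue field -/

section InjectiveHull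

/-- Take `C` maximal among submodules disjoint from `K` (Zorn); the image of `K` in `J ⧸ C` is then
essential. -/
theorem exists_essential_quotient {R : Type*} [CommRing R] (J : Type*) [AddCommGroup J] [Module R J] (K : Submodule R J) :
    ∃ C : Submodule R J, Disjoint C K ∧
      ∀ P : Submodule R (J ⧸ C), Disjoint P (K.map C.mkQ) → P = ⊥ := by
  obtain ⟨C, hC⟩ := zorn_le₀ {C : Submodule R J | Disjoint C K} fun c hc hchain =>
    ⟨sSup c, (hchain.directedOn.disjoint_sSup_left).mpr fun b hb => hc hb, fun z hz => le_sSup hz⟩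
  refine ⟨C, hC.prop, fun P hP => ?_⟩
  have hle : C ≤ P.comap C.mkQ := fun x hx => by
    rw [Submodule.mem_comap, Submodule.mkQ_apply, (Submodule.Quotient.mk_eq_zero C).mpr hx]
    exact P.zero_mem
  have hdisj : Disjoint (P.comap C.mkQ) K := by
    rw [Submodule.disjoint_def]
    intro x hx hxK
    have h0 := Submodule.disjoint_def.mp hP _ hx (Submodule.mem_map_of_mem hxK)
    exact Submodule.disjoint_def.mp hC.prop x ((Submodule.Quotient.mk_eq_zero C).mp h0) hxK
  have heq : P.comap C.mkQ ≤ C := hC.le_of_ge hdisj hle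
  rw [eq_bot_iff]
  intro y hy
  obtain ⟨x, rfl⟩ := Submodule.mkQ_surjective C y
  exact (Submodule.Quotient.mk_eq_zero C).mpr (heq hy)

variable {R : Type u} [CommRing R] [IsArtinianRing R] [IsLocalRing R]

/-- Multiplication by finitely many generators of `𝔪` maps the `𝔪^(n+1)`-torsion to a finite power
of the `𝔪^n`-torsion, with kernel in the socle. -/
theorem isNoetherian_torsionBySet_pow (N : Type*) [AddCommGroup N] [Module R N]
    [IsNoetherian R (Submodule.torsionBySet R N (IsLocalRing.maximalIdeal R : Set R))] (n : ℕ) :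
    IsNoetherian R
      (Submodule.torsionBySet R N ((IsLocalRing.maximalIdeal R ^ n : Ideal R) : Set R)) := by
  induction n with
  | zero =>
    have : Submodule.torsionBySet R N ((IsLocalRing.maximalIdeal R ^ 0 : Ideal R) : Set R) = ⊥ := by
      simp [Ideal.one_eq_top, Submodule.torsionBySet_univ]
    rw [this]
    infer_instance
  | succ n ih =>
    obtain ⟨S, hS⟩ := (isNoetherianRing_iff_ideal_fg R).mp inferInstance
      (IsLocalRing.maximalIdeal R)
    let T := fun n : ℕ =>
      Submodule.torsionBySet R N ((IsLocalRing.maximalIdeal R ^ n : Ideal R) : Set R)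
    let g : T (n + 1) →ₗ[R] (S → T n) := LinearMap.pi fun a =>
      (LinearMap.lsmul R N a ∘ₗ (T (n + 1)).subtype).codRestrict (T n) fun x => by
        refine (Submodule.mem_torsionBySet_iff _ _).mpr fun r => ?_
        have hr : (r : R) * a ∈ IsLocalRing.maximalIdeal R ^ (n + 1) :=
          Ideal.mul_mem_mul r.2 (hS ▸ Submodule.subset_span a.2)
        have := (Submodule.mem_torsionBySet_iff _ _).mp x.2 ⟨_, hr⟩
        simpa [mul_smul] using this
    have hmem : ∀ x : LinearMap.ker g, ((x : T (n + 1)) : N) ∈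
        Submodule.torsionBySet R N (IsLocalRing.maximalIdeal R : Set R) := by
      intro x
      rw [← hS]
      rw [← Submodule.torsionBySet_eq_torsionBySet_span, Submodule.mem_torsionBySet_iff]
      intro a
      exact congrArg Subtype.val (congrFun x.2 a)
    have : IsNoetherian R (LinearMap.ker g) :=
      isNoetherian_of_injective
        (((T (n + 1)).subtype ∘ₗ (LinearMap.ker g).subtype).codRestrict _ hmem)
        fun x y h => by
          have h' := congrArg (Submodule.subtype _) h
          exact Subtype.ext (Subtype.ext h')
    have : IsNoetherian R (T n) := ih
    exact isNoetherian_of_range_eq_ker (LinearMap.ker g).subtype g (by simp)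

theorem isNoetherian_of_isNoetherian_torsionBySet (N : Type*) [AddCommGroup N] [Module R N]
    [IsNoetherian R (Submodule.torsionBySet R N (IsLocalRing.maximalIdeal R : Set R))] :
    IsNoetherian R N := by
  obtain ⟨n, hn⟩ : IsNilpotent (IsLocalRing.maximalIdeal R) := by
    rw [← IsLocalRing.jacobson_eq_maximalIdeal ⊥ bot_ne_top]
    exact IsArtinianRing.isNilpotent_jacobson_bot
  have h := isNoetherian_torsionBySet_pow (R := R) N n
  have : Submodule.torsionBySet R N ((IsLocalRing.maximalIdeal R ^ n : Ideal R) : Set R) = ⊤ := by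
    rw [hn, eq_top_iff]
    intro x _
    rw [Submodule.mem_torsionBySet_iff]
    rintro ⟨r, hr⟩
    have : r = 0 := by simpa using hr
    simp [this]
  rw [this] at h
  exact isNoetherian_of_linearEquiv (Submodule.topEquiv (R := R) (M := N))

-- The hull is an essential quotient `J ⧸ C` of an injective `J` containing `k`. Its socle is `k`,
-- so it is noetherian, hence artinian. This finiteness makes it a direct summand of `J`, so it is
-- injective.
variable (R) in
theorem exists_injective_hull_residueField :
    ∃ (E : Type u) (_ : AddCommGroup E) (_ : Module R E)
      (ι : IsLocalRing.ResidueField R →ₗ[R] E), Module.Injective R E ∧ Module.Finite R E ∧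
      Function.Injective ι ∧
      ∀ x : E, (∀ r ∈ IsLocalRing.maximalIdeal R, r • x = 0) → x ∈ LinearMap.range ι := by
  obtain ⟨⟨J, _, f, _⟩⟩ := EnoughInjectives.presentation (residueModule R)
  have hJ : Module.Injective R J := Module.injective_module_of_injective_object R J
  have hf : Function.Injective f.hom := (ModuleCat.mono_iff_injective f).mp inferInstance
  obtain ⟨C, hC, hess⟩ := exists_essential_quotient J (LinearMap.range f.hom)
  let ι : IsLocalRing.ResidueField R →ₗ[R] J ⧸ C := C.mkQ ∘ₗ f.hom
  have hι : Function.Injective ι := by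
    rw [injective_iff_map_eq_zero]
    intro x hx
    exact hf ((Submodule.disjoint_def.mp hC _ ((Submodule.Quotient.mk_eq_zero C).mp hx)
      ⟨x, rfl⟩).trans (map_zero _).symm)
  have hrange : (LinearMap.range f.hom).map C.mkQ = LinearMap.range ι :=
    (LinearMap.range_comp _ _).symm
  rw [hrange] at hess
  have hinj : ∀ {X : Type u} [AddCommGroup X] [Module R X] (g : (J ⧸ C) →ₗ[R] X),
      Function.Injective (g ∘ₗ ι) → Function.Injective g := by
    intro X _ _ g hg
    rw [← LinearMap.ker_eq_bot]
    refine hess _ (Submodule.disjoint_def.mpr ?_)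
    rintro _ hx ⟨x, rfl⟩
    have : x = 0 := hg (by rw [map_zero]; exact hx)
    rw [this, map_zero]
  have hsoc : ∀ x : J ⧸ C, (∀ r ∈ IsLocalRing.maximalIdeal R, r • x = 0) →
      x ∈ LinearMap.range ι := by
    intro x hx
    by_contra hxι
    have : Submodule.span R {x} = ⊥ := by
      refine hess _ (Submodule.disjoint_def.mpr fun y hy hy' => ?_)
      obtain ⟨r, rfl⟩ := Submodule.mem_span_singleton.mp hy
      by_cases hr : r ∈ IsLocalRing.maximalIdeal R
      · exact hx r hr
      · have hu : IsUnit r := by simpa using hr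
        exact absurd ((Submodule.smul_mem_iff_of_isUnit _ hu).mp hy') hxι
    rw [Submodule.span_singleton_eq_bot] at this
    exact hxι (this ▸ Submodule.zero_mem _)
  have : IsNoetherian R
      (Submodule.torsionBySet R (J ⧸ C) (IsLocalRing.maximalIdeal R : Set R)) := by
    have := isSimpleModule_residueField R
    have : IsNoetherian R (LinearMap.range ι) := inferInstance
    refine isNoetherian_of_le (t := LinearMap.range ι) fun x hx => hsoc x fun r hr => ?_
    exact (Submodule.mem_torsionBySet_iff _ _).mp hx ⟨r, hr⟩
  have : IsNoetherian R (J ⧸ C) := isNoetherian_of_isNoetherian_torsionBySet _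
  obtain ⟨φ, hφ⟩ := (Module.Baer.of_injective hJ).extension_property ι hι f.hom
  -- This endomorphism restricts to `ι` on `k`, so it is injective by essentiality, and then
  -- bijective because `J ⧸ C` is artinian.
  have hψ : Function.Injective (C.mkQ ∘ₗ φ) := hinj _ (by
    rw [LinearMap.comp_assoc, hφ]; exact hι)
  let e : (J ⧸ C) ≃ₗ[R] (J ⧸ C) := LinearEquiv.ofBijective (C.mkQ ∘ₗ φ)
    ⟨hψ, IsArtinian.surjective_of_injective_endomorphism _ hψ⟩
  refine ⟨J ⧸ C, inferInstance, inferInstance, ι, ⟨fun X Y _ _ _ _ i hi g => ?_⟩, inferInstance,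
    hι, hsoc⟩
  obtain ⟨h, hh⟩ := (Module.Baer.of_injective hJ).extension_property i hi (φ ∘ₗ g)
  refine ⟨e.symm.toLinearMap ∘ₗ C.mkQ ∘ₗ h, fun x => ?_⟩
  have : h (i x) = φ (g x) := LinearMap.congr_fun hh x
  change e.symm (C.mkQ (h (i x))) = g x
  rw [this]
  exact e.symm_apply_apply (g x)

-- `Hom(-, E)` is exact and preserves length one, so it preserves every finite length.
omit [IsArtinianRing R] in
theorem length_linearMap_eq_length {E : Type u} [AddCommGroup E] [Module R E]
    [Module.Injective R E]
    (hE : Module.length R (IsLocalRing.ResidueField R →ₗ[R] E) = 1)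
    {N : Type u} [AddCommGroup N] [Module R N] (hN : IsFiniteLength R N) :
    Module.length R (N →ₗ[R] E) = Module.length R N := by
  induction hN with
  | of_subsingleton => rw [Module.length_eq_zero, Module.length_eq_zero]
  | @of_simple_quotient M _ _ N hs hN ih =>
    obtain ⟨I, hI, ⟨e⟩⟩ := isSimpleModule_iff_quot_maximal.mp hs
    obtain rfl := IsLocalRing.eq_maximalIdeal hI
    have h1 : Module.length R ((M ⧸ N) →ₗ[R] E) = 1 := by
      rw [← hE]
      exact (LinearEquiv.congrLeft E R e).length_eq
    rw [Module.length_eq_add_of_exact (LinearMap.lcomp R E N.mkQ) (LinearMap.lcomp R E N.subtype)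
        ?_ ?_ ?_, Module.length_eq_add_of_exact N.subtype N.mkQ (Submodule.subtype_injective N)
        (Submodule.mkQ_surjective N) (LinearMap.exact_subtype_mkQ N), ih, h1, add_comm,
        Module.length_eq_one R (M ⧸ N)]
    · intro g g' h
      exact (LinearMap.cancel_right (Submodule.mkQ_surjective N)).mp h
    · exact fun g => (Module.Baer.of_injective ‹Module.Injective R E›).extension_property _
        (Submodule.subtype_injective N) g
    · intro g
      constructor
      · intro h
        refine ⟨N.liftQ g fun x hx => LinearMap.congr_fun h ⟨x, hx⟩, ?_⟩
        ext x
        rfl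
      · rintro ⟨h, rfl⟩
        ext x
        change h (N.mkQ x) = 0
        rw [show N.mkQ x = 0 from (Submodule.Quotient.mk_eq_zero N).mpr x.2, map_zero]

theorem length_eq_length_self_of_injective {E : Type u} [AddCommGroup E] [Module R E]
    [Module.Injective R E]
    (hE : Module.length R (IsLocalRing.ResidueField R →ₗ[R] E) = 1) :
    Module.length R E = Module.length R R := by
  rw [← length_linearMap_eq_length hE (N := R)
    (Module.length_ne_top_iff.mp Module.length_ne_top)]
  exact ((LinearMap.ringLmapEquivSelf R R E).length_eq).symm

/-- Given a nonzero socle element `x` of `N`, extend `k → N`, `1 ↦ x`, along `k → R`, `1 ↦ s`. The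
extension sends `s` to `x`, so `x` lies in `sN = 0`. -/
theorem subsingleton_of_injective_of_smul_eq_zero {N : Type u} [AddCommGroup N] [Module R N]
    [Module.Injective R N] {s : R} (hs : s ≠ 0)
    (hs' : ∀ r ∈ IsLocalRing.maximalIdeal R, r • s = 0) (h : ∀ x : N, s • x = 0) :
    Subsingleton N := by
  by_contra hN
  rw [not_subsingleton_iff_nontrivial] at hN
  obtain ⟨x, hx, hx'⟩ := exists_ne_zero_smul_eq_zero (R := R) N
  obtain ⟨g, rfl⟩ := exists_linearMap_residueField hx'
  obtain ⟨j, rfl⟩ := exists_linearMap_residueField hs'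
  obtain ⟨φ, hφ⟩ := (Module.Baer.of_injective ‹Module.Injective R N›).extension_property j
    (injective_of_map_one_ne_zero hs) g
  refine hx ?_
  rw [← hφ, LinearMap.comp_apply, ← mul_one (j 1), ← smul_eq_mul, map_smul]
  exact h _

end InjectiveHull

/-! ### Minimal embeddings into powers of the hull, and Bass numbers -/

section MinimalCocover

variable {R : Type u} [CommRing R] [IsArtinianRing R] [IsLocalRing R]
  {E : Type u} [AddCommGroup E] [Module R E]

/-- Extend the `k`-coordinates on the socle of `X` to maps `X → E`. A nonzero kernel would meet the
socle, where the map is injective. -/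
theorem exists_minimal_cocover [Module.Injective R E] {ι : IsLocalRing.ResidueField R →ₗ[R] E}
    (hι : Function.Injective ι)
    (hE : ∀ x : E, (∀ r ∈ IsLocalRing.maximalIdeal R, r • x = 0) → x ∈ LinearMap.range ι)
    (X : Type u) [AddCommGroup X] [Module R X] [Module.Finite R X] :
    ∃ (b : ℕ) (f : X →ₗ[R] (Fin b → E)), Function.Injective f ∧
      ∀ y : Fin b → E, (∀ r ∈ IsLocalRing.maximalIdeal R, r • y = 0) → y ∈ LinearMap.range f := by
  let T := Submodule.torsionBySet R X (IsLocalRing.maximalIdeal R : Set R)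
  have hT : Module.IsTorsionBySet R T (IsLocalRing.maximalIdeal R : Set R) :=
    Submodule.torsionBySet_isTorsionBySet _
  let : Module (IsLocalRing.ResidueField R) T := hT.module
  have : IsScalarTower R (IsLocalRing.ResidueField R) T := hT.isScalarTower
  have : Module.Finite (IsLocalRing.ResidueField R) T :=
    Module.Finite.of_restrictScalars_finite R _ _
  let e : T ≃ₗ[R] (Fin (Module.finrank (IsLocalRing.ResidueField R) T) →
      IsLocalRing.ResidueField R) :=
    (Module.finBasis (IsLocalRing.ResidueField R) T).equivFun.restrictScalars R
  choose g hg using fun i => (Module.Baer.of_injective ‹Module.Injective R E›).extension_property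
    T.subtype T.subtype_injective (ι ∘ₗ LinearMap.proj i ∘ₗ e.toLinearMap)
  have hg' : ∀ (x : T) i, g i x = ι (e x i) := fun x i => LinearMap.congr_fun (hg i) x
  refine ⟨_, LinearMap.pi g, ?_, fun y hy => ?_⟩
  · rw [← LinearMap.ker_eq_bot, ← Submodule.subsingleton_iff_eq_bot]
    by_contra h
    rw [not_subsingleton_iff_nontrivial] at h
    obtain ⟨x, hx, hx'⟩ :=
      exists_ne_zero_smul_eq_zero (R := R) (LinearMap.ker (LinearMap.pi g))
    have hxT : (x : X) ∈ T := (Submodule.mem_torsionBySet_iff _ _).mpr fun r =>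
      congrArg Subtype.val (hx' r r.2)
    have h0 : e ⟨x, hxT⟩ = 0 := by
      ext i
      refine hι ?_
      rw [← hg', Pi.zero_apply, map_zero]
      exact congrFun x.2 i
    rw [LinearEquiv.map_eq_zero_iff] at h0
    have h1 := congrArg T.subtype h0
    exact hx (Subtype.ext h1)
  · choose c hc using fun i => hE (y i) fun r hr => congrFun (hy r hr) i
    refine ⟨e.symm c, ?_⟩
    ext i
    rw [LinearMap.pi_apply, hg', LinearEquiv.apply_symm_apply, hc]

variable {X : Type u} [AddCommGroup X] [Module R X] {b : ℕ} {f : X →ₗ[R] (Fin b → E)}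

omit [IsArtinianRing R] in
theorem length_ext_zero_of_minimal_cocover
    (hE : Module.length R (IsLocalRing.ResidueField R →ₗ[R] E) = 1) (hf : Function.Injective f)
    (hf' : ∀ y : Fin b → E, (∀ r ∈ IsLocalRing.maximalIdeal R, r • y = 0) →
      y ∈ LinearMap.range f) :
    Module.length R (Abelian.Ext (residueModule R) (ModuleCat.of R X) 0) = b := by
  rw [length_ext_zero_eq_length_linearMap]
  refine (length_residueField_linearMap_eq f hf hf').trans ?_
  rw [length_residueField_linearMap_pi, hE, mul_one]

omit [IsArtinianRing R] in
theorem length_ext_succ_of_minimal_cocover [Module.Injective R E] (hf : Function.Injective f)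
    (hf' : ∀ y : Fin b → E, (∀ r ∈ IsLocalRing.maximalIdeal R, r • y = 0) →
      y ∈ LinearMap.range f) (n : ℕ) :
    Module.length R (Abelian.Ext (residueModule R) (ModuleCat.of R X) (n + 1)) =
      Module.length R
        (Abelian.Ext (residueModule R) (ModuleCat.of R ((Fin b → E) ⧸ LinearMap.range f)) n) := by
  let S : ShortComplex (ModuleCat.{u} R) :=
    ModuleCat.shortComplexOfCompEqZero f (LinearMap.range f).mkQ
      f.exact_map_mkQ_range.linearMap_comp_eq_zero
  have hS : S.ShortExact := ModuleCat.shortComplex_shortExact S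
    f.exact_map_mkQ_range hf (Submodule.mkQ_surjective _)
  have : Injective S.X₂ := Module.injective_object_of_injective_module R (Fin b → E)
  refine length_ext_succ_eq_of_injective hS _ (fun g => ?_) n
  ext x
  exact (Submodule.Quotient.mk_eq_zero _).mpr
    (hf' _ fun r hr => smul_map_residueField_eq_zero g.hom hr x)

omit [IsArtinianRing R] [IsLocalRing R] in
theorem length_quotient_add_length_of_injective (hf : Function.Injective f) :
    Module.length R ((Fin b → E) ⧸ LinearMap.range f) + Module.length R X =
      b * Module.length R E := by
  rw [add_comm, ← Module.length_eq_add_of_exact f (LinearMap.range f).mkQ hf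
    (Submodule.mkQ_surjective _) f.exact_map_mkQ_range, Module.length_pi_of_fintype]
  simp

omit [IsArtinianRing R] [IsLocalRing R] in
theorem injective_of_subsingleton_quotient [Module.Injective R E] (hf : Function.Injective f)
    [h : Subsingleton ((Fin b → E) ⧸ LinearMap.range f)] : Module.Injective R X := by
  have hs : Function.Surjective f := LinearMap.range_eq_top.mp
    (Submodule.Quotient.subsingleton_iff.mp h)
  exact ((Module.Baer.of_injective (inferInstance : Module.Injective R (Fin b → E))).of_equiv
    (LinearEquiv.ofBijective f ⟨hf, hs⟩).symm).injective

/-- For a socle element `s` of `R`, `𝔪` kills `sE^b`. So `sE^b` lies in the range of `f`, and `s`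
kills the quotient. -/
theorem subsingleton_quotient_of_injective
    (hf' : ∀ y : Fin b → E, (∀ r ∈ IsLocalRing.maximalIdeal R, r • y = 0) →
      y ∈ LinearMap.range f)
    [Module.Injective R ((Fin b → E) ⧸ LinearMap.range f)] :
    Subsingleton ((Fin b → E) ⧸ LinearMap.range f) := by
  obtain ⟨s, hs, hs'⟩ := exists_ne_zero_smul_eq_zero (R := R) R
  refine subsingleton_of_injective_of_smul_eq_zero hs hs' fun x => ?_
  obtain ⟨y, rfl⟩ := Submodule.mkQ_surjective _ x
  rw [← map_smul]
  refine (Submodule.Quotient.mk_eq_zero _).mpr (hf' _ fun r hr => ?_)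
  rw [← mul_smul, ← smul_eq_mul, hs' r hr, zero_smul]

end MinimalCocover

section Artinian

variable {R : Type u} [CommRing R] [IsArtinianRing R] [IsLocalRing R]

/-- Dual of `free_of_length_ext_residue_le_one`; the same count works because `ℓ(E) = ℓ(R)`. -/
theorem injective_of_length_ext_residue_le_one (X : Type u) [AddCommGroup X] [Module R X]
    [Module.Finite R X] (hX : Module.length R R ∣ Module.length R X) (n : ℕ)
    (hn : Module.length R (Abelian.Ext (residueModule R) (ModuleCat.of R X) n) ≤ 1) :
    Module.Injective R X := by
  obtain ⟨E, _, _, ι, _, _, hι, hE⟩ := exists_injective_hull_residueField R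
  have hE1 : Module.length R (IsLocalRing.ResidueField R →ₗ[R] E) = 1 := by
    rw [← length_residueField_linearMap_eq ι hι hE, length_residueField_linearMap_residueField]
  obtain ⟨b, f, hf, hf'⟩ := exists_minimal_cocover hι hE X
  have hl := length_quotient_add_length_of_injective (R := R) hf
  rw [length_eq_length_self_of_injective hE1] at hl
  suffices Subsingleton ((Fin b → E) ⧸ LinearMap.range f) from injective_of_subsingleton_quotient hf
  induction n generalizing X b with
  | zero =>
    rw [length_ext_zero_of_minimal_cocover hE1 hf hf'] at hn
    have hb : b ≤ 1 := by exact_mod_cast hn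
    obtain ⟨c, hc⟩ := hX
    rcases Nat.le_one_iff_eq_zero_or_eq_one.mp hb with rfl | rfl
    · infer_instance
    · rw [← Module.length_eq_zero_iff (R := R)]
      by_cases h0 : c = 0
      · subst h0
        rw [mul_zero, Module.length_eq_zero_iff] at hc
        -- Here `X = 0`, so `Hom(k, X)` cannot have length `b = 1`.
        have := length_ext_zero_of_minimal_cocover hE1 hf hf'
        rw [length_ext_zero_eq_length_linearMap, Module.length_eq_zero] at this
        simp at this
      · have h1 : Module.length R R ≤ Module.length R X := by
          rw [hc]; exact le_mul_of_one_le_right' (Order.one_le_iff_ne_zero.mpr h0)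
        have h2 : Module.length R ((Fin 1 → E) ⧸ LinearMap.range f) + Module.length R R ≤
            0 + Module.length R R := by
          calc _ ≤ Module.length R ((Fin 1 → E) ⧸ LinearMap.range f) + Module.length R X := by
                gcongr
            _ = _ := by rw [hl]; simp
        exact le_antisymm ((ENat.add_le_add_iff_right length_self_ne_top).mp h2) bot_le
  | succ n ih =>
    rw [length_ext_succ_of_minimal_cocover hf hf'] at hn
    have hd := enat_dvd_of_add_eq_mul length_self_ne_zero length_self_ne_top hl hX
    obtain ⟨b', f', hf₁, hf₂⟩ := exists_minimal_cocover hι hE ((Fin b → E) ⧸ LinearMap.range f)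
    have hl' := length_quotient_add_length_of_injective (R := R) hf₁
    rw [length_eq_length_self_of_injective hE1] at hl'
    have := ih _ hd hn b' f' hf₁ hf₂ hl'
    have := injective_of_subsingleton_quotient hf₁
    exact subsingleton_quotient_of_injective hf'

theorem injective_self_of_length_ext_eq_one {n : ℕ}
    (hn : Module.length R (Abelian.Ext (residueModule R) (ModuleCat.of R R) n) = 1) :
    n = 0 ∧ Injective (ModuleCat.of R R) := by
  have := injective_of_length_ext_residue_le_one R dvd_rfl n hn.le
  have hinj : Injective (ModuleCat.of R R) := Module.injective_object_of_injective_module R R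
  refine ⟨?_, hinj⟩
  by_contra h0
  obtain ⟨m, rfl⟩ := Nat.exists_eq_succ_of_ne_zero h0
  have : Subsingleton (Abelian.Ext (residueModule R) (ModuleCat.of R R) (m + 1)) :=
    ⟨fun x y => by rw [Abelian.Ext.eq_zero_of_injective x, Abelian.Ext.eq_zero_of_injective y]⟩
  rw [Module.length_eq_zero] at hn
  exact zero_ne_one hn

end Artinian

/-! ### Rees' change of rings for Ext -/

section Rees

variable {R : Type u} [CommRing R] (x : R)

/-- Restriction of scalars along `R → R ⧸ (x)`. -/
noncomputable abbrev quotientRestrictScalars :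
    ModuleCat.{u} (R ⧸ Ideal.span {x}) ⥤ ModuleCat.{u} R :=
  ModuleCat.restrictScalars (Ideal.Quotient.mk (Ideal.span {x}))

theorem smul_quotientRestrictScalars (N : ModuleCat.{u} (R ⧸ Ideal.span {x})) (r : R)
    (y : (quotientRestrictScalars x).obj N) :
    r • y = (Ideal.Quotient.mk (Ideal.span {x}) r • (show N from y) : N) := rfl

theorem smul_quotientRestrictScalars_eq_zero (N : ModuleCat.{u} (R ⧸ Ideal.span {x}))
    (y : (quotientRestrictScalars x).obj N) : x • y = 0 := by
  rw [smul_quotientRestrictScalars,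
    Ideal.Quotient.eq_zero_iff_mem.mpr (Ideal.mem_span_singleton_self x)]
  exact zero_smul _ (show N from y)

theorem exists_map_quotientRestrictScalars {M N : ModuleCat.{u} (R ⧸ Ideal.span {x})}
    (g : (quotientRestrictScalars x).obj M ⟶ (quotientRestrictScalars x).obj N) :
    ∃ f : M ⟶ N, (quotientRestrictScalars x).map f = g := by
  refine ⟨ModuleCat.ofHom
    { toFun := fun y => g.hom y
      map_add' := fun y z => g.hom.map_add y z
      map_smul' := fun r y => ?_ }, rfl⟩
  obtain ⟨r, rfl⟩ := Ideal.Quotient.mk_surjective r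
  exact g.hom.map_smul r y

/-- The quotient map from a free `R`-module to the free `R ⧸ (x)`-module on the same basis. -/
noncomputable def finsuppQuotientMap (I : Type u) : (I →₀ R) →ₗ[R]
    (quotientRestrictScalars x).obj (ModuleCat.of _ (I →₀ R ⧸ Ideal.span {x})) where
  toFun f := f.mapRange (Ideal.Quotient.mk (Ideal.span {x})) (map_zero _)
  map_add' f g := Finsupp.mapRange_add (map_add _) f g
  map_smul' r f := Finsupp.ext (M := R ⧸ Ideal.span {x}) fun i =>
    map_mul (Ideal.Quotient.mk (Ideal.span {x})) r (f i)

variable {x}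

theorem exact_lsmul_finsuppQuotientMap (I : Type u) :
    Function.Exact (LinearMap.lsmul R (I →₀ R) x) (finsuppQuotientMap x I) := by
  intro f
  constructor
  · intro hf
    have h : ∀ i, ∃ c, x * c = f i := fun i => by
      have h0 : Ideal.Quotient.mk (Ideal.span {x}) (f i) = 0 :=
        DFunLike.congr_fun (F := I →₀ R ⧸ Ideal.span {x}) hf i
      obtain ⟨c, hc⟩ := Ideal.mem_span_singleton.mp (Ideal.Quotient.eq_zero_iff_mem.mp h0)
      exact ⟨c, hc.symm⟩
    choose c hc using h
    classical
    -- The chosen `c i` need not vanish off the support of `f`, so it is reset to `0` there.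
    refine ⟨Finsupp.onFinset f.support (fun i => if f i = 0 then 0 else c i)
      (by simp +contextual), ?_⟩
    ext i
    by_cases hi : f i = 0
    · simp [hi]
    · simp [hi, hc]
  · rintro ⟨g, rfl⟩
    rw [LinearMap.lsmul_apply, map_smul]
    exact smul_quotientRestrictScalars_eq_zero x _ _

theorem hasProjectiveDimensionLT_quotientRestrictScalars (hx : IsSMulRegular R x) (I : Type u) :
    HasProjectiveDimensionLT
      ((quotientRestrictScalars x).obj (ModuleCat.of _ (I →₀ R ⧸ Ideal.span {x}))) 2 := by
  let S : ShortComplex (ModuleCat.{u} R) :=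
    ModuleCat.shortComplexOfCompEqZero _ _
      (exact_lsmul_finsuppQuotientMap (x := x) I).linearMap_comp_eq_zero
  have hS : S.ShortExact := ModuleCat.shortComplex_shortExact S
    (exact_lsmul_finsuppQuotientMap I)
    (fun f g h => by
      ext i
      exact hx (DFunLike.congr_fun h i))
    (Finsupp.mapRange_surjective (Ideal.Quotient.mk (Ideal.span {x})) (map_zero _)
      Ideal.Quotient.mk_surjective)
  have h : Projective (ModuleCat.of R (I →₀ R)) := inferInstance
  have h₁ : Projective S.X₁ := h
  have h₂ : Projective S.X₂ := h
  exact hS.hasProjectiveDimensionLT_X₃ 1 inferInstance inferInstance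

variable (x) in
/-- The quotient map `R → R ⧸ (x)` as a linear map over `R`. -/
noncomputable def selfQuotientMap : R →ₗ[R]
    (quotientRestrictScalars x).obj (ModuleCat.of _ (R ⧸ Ideal.span {x})) where
  toFun r := Ideal.Quotient.mk (Ideal.span {x}) r
  map_add' f g := map_add (Ideal.Quotient.mk (Ideal.span {x})) f g
  map_smul' r f := map_mul (Ideal.Quotient.mk (Ideal.span {x})) r f

theorem exact_lsmul_selfQuotientMap :
    Function.Exact (LinearMap.lsmul R R x) (selfQuotientMap x) := by
  intro f
  refine (Ideal.Quotient.eq_zero_iff_mem.trans Ideal.mem_span_singleton).trans ?_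
  exact ⟨fun ⟨c, hc⟩ => ⟨c, hc.symm⟩, fun ⟨c, hc⟩ => ⟨c, hc.symm⟩⟩

variable (x) in
/-- The sequence `R → R → R ⧸ (x)` with first map multiplication by `x`. -/
noncomputable abbrev selfShortComplex : ShortComplex (ModuleCat.{u} R) :=
  ModuleCat.shortComplexOfCompEqZero _ _
    (exact_lsmul_selfQuotientMap (x := x)).linearMap_comp_eq_zero

theorem selfShortComplex_shortExact (hx : IsSMulRegular R x) :
    (selfShortComplex x).ShortExact :=
  ModuleCat.shortComplex_shortExact _ exact_lsmul_selfQuotientMap hx Ideal.Quotient.mk_surjective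

/-- Rees' comparison map `Ext^n(N, R ⧸ (x)) → Ext^(n+1)(N, R)`. -/
noncomputable def reesMap (hx : IsSMulRegular R x) (N : ModuleCat.{u} (R ⧸ Ideal.span {x}))
    (n : ℕ) : Abelian.Ext N (ModuleCat.of _ (R ⧸ Ideal.span {x})) n →+
    Abelian.Ext ((quotientRestrictScalars x).obj N) (ModuleCat.of R R) (n + 1) where
  toFun e := (e.mapExactFunctor (quotientRestrictScalars x)).comp
    (selfShortComplex_shortExact hx).extClass rfl
  map_zero' := by
    rw [Abelian.Ext.mapExactFunctor_zero]
    exact Abelian.Ext.zero_comp _ _ (selfShortComplex_shortExact hx).extClass _ _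
  map_add' e e' := by
    rw [Abelian.Ext.mapExactFunctor_add]
    exact Abelian.Ext.add_comp _ _ (selfShortComplex_shortExact hx).extClass _

theorem reesMap_apply (hx : IsSMulRegular R x) (N : ModuleCat.{u} (R ⧸ Ideal.span {x}))
    {n : ℕ} (e : Abelian.Ext N (ModuleCat.of _ (R ⧸ Ideal.span {x})) n) :
    reesMap hx N n e = (e.mapExactFunctor (quotientRestrictScalars x)).comp
      (selfShortComplex_shortExact hx).extClass rfl := rfl

theorem reesMap_smul (hx : IsSMulRegular R x) (N : ModuleCat.{u} (R ⧸ Ideal.span {x}))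
    {n : ℕ} (r : R) (e : Abelian.Ext N (ModuleCat.of _ (R ⧸ Ideal.span {x})) n) :
    reesMap hx N n (Ideal.Quotient.mk (Ideal.span {x}) r • e) = r • reesMap hx N n e := by
  have h : (quotientRestrictScalars x).map
      (Ideal.Quotient.mk (Ideal.span {x}) r • 𝟙 (ModuleCat.of _ (R ⧸ Ideal.span {x}))) =
      r • 𝟙 _ := rfl
  rw [reesMap_apply, reesMap_apply, Abelian.Ext.smul_eq_comp_mk₀,
    Abelian.Ext.mapExactFunctor_comp, Abelian.Ext.mapExactFunctor_mk₀, h,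
    ← Abelian.Ext.smul_eq_comp_mk₀, Abelian.Ext.smul_comp]

theorem reesMap_mk₀_comp (hx : IsSMulRegular R x) {M N : ModuleCat.{u} (R ⧸ Ideal.span {x})}
    (f : M ⟶ N) {n : ℕ} (e : Abelian.Ext N (ModuleCat.of _ (R ⧸ Ideal.span {x})) n) :
    reesMap hx M n ((Abelian.Ext.mk₀ f).comp e (zero_add n)) =
      (Abelian.Ext.mk₀ ((quotientRestrictScalars x).map f)).comp (reesMap hx N n e)
        (zero_add (n + 1)) := by
  rw [reesMap_apply, reesMap_apply, Abelian.Ext.mapExactFunctor_comp,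
    Abelian.Ext.mapExactFunctor_mk₀]
  exact Abelian.Ext.comp_assoc _ _ _ _ _ (by omega)

theorem reesMap_extClass_comp (hx : IsSMulRegular R x)
    {S : ShortComplex (ModuleCat.{u} (R ⧸ Ideal.span {x}))} (hS : S.ShortExact)
    {n : ℕ} (e : Abelian.Ext S.X₁ (ModuleCat.of _ (R ⧸ Ideal.span {x})) n) :
    reesMap hx S.X₃ (n + 1) (hS.extClass.comp e (add_comm 1 n)) =
      (hS.map_of_exact (quotientRestrictScalars x)).extClass.comp (reesMap hx S.X₁ n e)
        (add_comm 1 (n + 1)) := by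
  rw [reesMap_apply, reesMap_apply, Abelian.Ext.mapExactFunctor_comp,
    Abelian.Ext.mapExactFunctor_extClass]
  exact Abelian.Ext.comp_assoc _ _ _ _ _ (by omega)

/-- Since `x` kills `N` and is regular on `R`, `Hom(N, R) = 0`, which gives injectivity. Since `x`
also kills `Ext^1(N, R)`, every class there comes from `Hom(N, R ⧸ (x))`. -/
theorem reesMap_zero_bijective (hx : IsSMulRegular R x)
    (N : ModuleCat.{u} (R ⧸ Ideal.span {x})) : Function.Bijective (reesMap hx N 0) := by
  constructor
  · rw [injective_iff_map_eq_zero]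
    intro e he
    obtain ⟨g, rfl⟩ := (Abelian.Ext.mk₀_bijective _ _).2 e
    rw [reesMap_apply, Abelian.Ext.mapExactFunctor_mk₀] at he
    obtain ⟨h, hh⟩ := Abelian.Ext.covariant_sequence_exact₃ _
      (selfShortComplex_shortExact hx) _ rfl he
    obtain ⟨h, rfl⟩ := (Abelian.Ext.mk₀_bijective _ _).2 h
    have h0 : h = 0 := by
      ext y
      refine hx ?_
      change x • h.hom y = x • 0
      rw [← map_smul, smul_quotientRestrictScalars_eq_zero, map_zero, smul_zero]
    rw [h0, Abelian.Ext.mk₀_zero, Abelian.Ext.zero_comp, eq_comm, Abelian.Ext.mk₀_eq_zero_iff] at hh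
    rw [(quotientRestrictScalars x).map_injective (hh.trans (Functor.map_zero _ _ _).symm),
      Abelian.Ext.mk₀_zero]
  · intro y
    have hxy : x • y = 0 := by
      have h0 : x • 𝟙 ((quotientRestrictScalars x).obj N) = 0 := by
        ext z
        exact smul_quotientRestrictScalars_eq_zero x N z
      have : x • y = (Abelian.Ext.mk₀ (x • 𝟙 ((quotientRestrictScalars x).obj N))).comp y
          (zero_add _) := by simp [Abelian.Ext.mk₀_smul]
      rw [this, h0, Abelian.Ext.mk₀_zero, Abelian.Ext.zero_comp]
    rw [Abelian.Ext.smul_eq_comp_mk₀] at hxy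
    obtain ⟨z, rfl⟩ := Abelian.Ext.covariant_sequence_exact₁ _
      (selfShortComplex_shortExact hx) y hxy rfl
    obtain ⟨z, rfl⟩ := (Abelian.Ext.mk₀_bijective _ _).2 z
    obtain ⟨f, rfl⟩ := exists_map_quotientRestrictScalars x (M := N)
      (N := ModuleCat.of _ (R ⧸ Ideal.span {x})) z
    exact ⟨Abelian.Ext.mk₀ f, by rw [reesMap_apply, Abelian.Ext.mapExactFunctor_mk₀]⟩

/-- Dimension shifting in `N` along a free `R ⧸ (x)`-cover, which has projective dimension at most
one over `R`. -/
theorem reesMap_bijective (hx : IsSMulRegular R x)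
    (N : ModuleCat.{u} (R ⧸ Ideal.span {x})) (n : ℕ) : Function.Bijective (reesMap hx N n) := by
  induction n generalizing N with
  | zero => exact reesMap_zero_bijective hx N
  | succ n ih =>
    let f : (N →₀ R ⧸ Ideal.span {x}) →ₗ[R ⧸ Ideal.span {x}] N :=
      Finsupp.linearCombination _ id
    have hS : f.shortComplexKer.ShortExact :=
      LinearMap.shortExact_shortComplexKer (Finsupp.linearCombination_id_surjective _ _)
    have hP : Projective f.shortComplexKer.X₂ :=
      inferInstanceAs (Projective (ModuleCat.of _ (N →₀ R ⧸ Ideal.span {x})))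
    have hFP : HasProjectiveDimensionLT
        (f.shortComplexKer.map (quotientRestrictScalars x)).X₂ 2 :=
      hasProjectiveDimensionLT_quotientRestrictScalars hx N
    have hFS := hS.map_of_exact (quotientRestrictScalars x)
    change Function.Bijective (reesMap hx f.shortComplexKer.X₃ (n + 1))
    constructor
    · rw [injective_iff_map_eq_zero]
      intro e he
      obtain ⟨w, rfl⟩ := Abelian.Ext.contravariant_sequence_exact₃ hS _ e
        (Abelian.Ext.eq_zero_of_projective _) (add_comm 1 n)
      rw [reesMap_extClass_comp] at he
      obtain ⟨v, hv⟩ := Abelian.Ext.contravariant_sequence_exact₁ hFS _ _ _ he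
      obtain ⟨t, rfl⟩ := (ih _).2 v
      have : (Abelian.Ext.mk₀ f.shortComplexKer.f).comp t (zero_add n) = w :=
        -- So `w` is restricted from the free module, and the connecting map kills it.
        (ih _).1 (by rw [reesMap_mk₀_comp]; exact hv)
      rw [← this]
      exact hS.extClass_comp_assoc _
    · intro y
      obtain ⟨z, rfl⟩ := Abelian.Ext.contravariant_sequence_exact₃ hFS _ y
        (Abelian.Ext.eq_zero_of_hasProjectiveDimensionLT _ 2 (by omega)) (add_comm 1 (n + 1))
      obtain ⟨w, rfl⟩ := (ih _).2 z
      exact ⟨hS.extClass.comp w (add_comm 1 n), reesMap_extClass_comp hx hS w⟩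

theorem length_ext_quotient_eq (hx : IsSMulRegular R x)
    (N : ModuleCat.{u} (R ⧸ Ideal.span {x})) (n : ℕ) :
    Module.length R (Abelian.Ext ((quotientRestrictScalars x).obj N) (ModuleCat.of R R) (n + 1)) =
      Module.length (R ⧸ Ideal.span {x})
        (Abelian.Ext N (ModuleCat.of _ (R ⧸ Ideal.span {x})) n) := by
  let e := AddEquiv.ofBijective _ (reesMap_bijective hx N n)
  have : RingHomSurjective (Ideal.Quotient.mk (Ideal.span {x})) :=
    ⟨Ideal.Quotient.mk_surjective⟩
  refine length_eq_of_bijective (σ := Ideal.Quotient.mk (Ideal.span {x}))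
    { e.symm with
      map_smul' := fun r y => ?_ } e.symm.bijective
  obtain ⟨y, rfl⟩ := e.surjective y
  change e.symm (r • e y) = Ideal.Quotient.mk (Ideal.span {x}) r • e.symm (e y)
  rw [AddEquiv.symm_apply_apply, AddEquiv.symm_apply_eq]
  exact (reesMap_smul hx N r y).symm

end Rees

/-! ### Injective dimension and regular elements -/

section InjectiveDimension

variable {R : Type u} [CommRing R]

theorem length_ext_eq_of_iso {X X' : ModuleCat.{u} R} (e : X ≅ X') (Y : ModuleCat.{u} R) (n : ℕ) :
    Module.length R (Abelian.Ext X Y n) = Module.length R (Abelian.Ext X' Y n) := by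
  refine length_eq_of_bijective
    (Abelian.Ext.bilinearCompOfLinear R X' X Y 0 n n (zero_add n) (Abelian.Ext.mk₀ e.inv))
    (Function.bijective_iff_has_inverse.mpr
      ⟨fun y => (Abelian.Ext.mk₀ e.hom).comp y (zero_add n), fun y => ?_, fun y => ?_⟩)
  · change (Abelian.Ext.mk₀ e.hom).comp ((Abelian.Ext.mk₀ e.inv).comp y (zero_add n)) (zero_add n) = y
    simp
  · change (Abelian.Ext.mk₀ e.inv).comp ((Abelian.Ext.mk₀ e.hom).comp y (zero_add n)) (zero_add n) = y
    simp

/-- Baer's criterion when `m = 0`; otherwise pass to the cokernel of an embedding into an injective.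
-/
theorem hasInjectiveDimensionLT_of_subsingleton_ext (m : ℕ) (X : ModuleCat.{u} R)
    (h : ∀ I : Ideal R, Subsingleton (Abelian.Ext (ModuleCat.of R (R ⧸ I)) X (m + 1))) :
    HasInjectiveDimensionLT X (m + 1) := by
  induction m generalizing X with
  | zero =>
    suffices Module.Baer R X by
      have := this.injective
      have : Injective X := Module.injective_object_of_injective_module R X
      infer_instance
    intro I g
    let S : ShortComplex (ModuleCat.{u} R) :=
      ModuleCat.shortComplexOfCompEqZero I.subtype (Submodule.mkQ I)
        (LinearMap.exact_subtype_mkQ I).linearMap_comp_eq_zero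
    have hS : S.ShortExact := ModuleCat.shortComplex_shortExact S
      (LinearMap.exact_subtype_mkQ I) I.subtype_injective (Submodule.mkQ_surjective I)
    have := h I
    obtain ⟨y, hy⟩ := Abelian.Ext.contravariant_sequence_exact₁ hS X
      (Abelian.Ext.mk₀ (ModuleCat.ofHom g : S.X₁ ⟶ X)) (add_comm 1 0) (Subsingleton.elim _ _)
    obtain ⟨y, rfl⟩ := (Abelian.Ext.mk₀_bijective _ _).2 y
    rw [Abelian.Ext.mk₀_comp_mk₀] at hy
    have hy := (Abelian.Ext.mk₀_bijective _ _).1 hy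
    exact ⟨y.hom, fun r hr => congrArg (fun φ => φ.hom ⟨r, hr⟩) hy⟩
  | succ m ih =>
    obtain ⟨⟨J, _, f, _⟩⟩ := EnoughInjectives.presentation X
    let S : ShortComplex (ModuleCat.{u} R) := ShortComplex.mk f _ (Limits.cokernel.condition f)
    have hS : S.ShortExact := { exact := ShortComplex.exact_cokernel f }
    have hJ : Injective S.X₂ := ‹Injective J›
    have : HasInjectiveDimensionLT S.X₃ (m + 1) := ih _ fun I => ⟨fun y z => by
      have := h I
      rw [← sub_eq_zero]
      obtain ⟨w, hw⟩ := Abelian.Ext.covariant_sequence_exact₃ _ hS (y - z) rfl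
        (Subsingleton.elim _ _)
      rw [← hw, Abelian.Ext.eq_zero_of_injective w, Abelian.Ext.zero_comp]⟩
    exact hS.hasInjectiveDimensionLT_X₁ (m + 1) this inferInstance

end InjectiveDimension

section RegularElement

variable {R : Type u} [CommRing R] {x : R}

theorem exists_iso_quotientRestrictScalars (N : ModuleCat.{u} R) (hN : ∀ y : N, x • y = 0) :
    ∃ N' : ModuleCat.{u} (R ⧸ Ideal.span {x}),
      Nonempty ((quotientRestrictScalars x).obj N' ≅ N) := by
  have hT : Module.IsTorsionBySet R N (Ideal.span {x} : Set R) := by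
    rintro y ⟨r, hr⟩
    obtain ⟨c, rfl⟩ := Ideal.mem_span_singleton.mp hr
    change (x * c) • y = 0
    rw [mul_smul, hN]
  let := hT.module
  exact ⟨ModuleCat.of _ N, ⟨LinearEquiv.toModuleIso
    { toFun := fun y => y
      invFun := fun y => y
      map_add' := fun _ _ => rfl
      map_smul' := fun _ _ => rfl
      left_inv := fun _ => rfl
      right_inv := fun _ => rfl }⟩⟩

theorem subsingleton_ext_of_smul_eq_zero (hx : IsSMulRegular R x) {n : ℕ}
    [HasInjectiveDimensionLE (ModuleCat.of (R ⧸ Ideal.span {x}) (R ⧸ Ideal.span {x})) n]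
    (N : ModuleCat.{u} R) (hN : ∀ y : N, x • y = 0) {j : ℕ} (hj : n + 2 ≤ j) :
    Subsingleton (Abelian.Ext N (ModuleCat.of R R) j) := by
  obtain ⟨N', ⟨e⟩⟩ := exists_iso_quotientRestrictScalars N hN
  obtain ⟨i, rfl⟩ : ∃ i, j = i + 1 := ⟨j - 1, by omega⟩
  rw [← Module.length_eq_zero_iff (R := R), ← length_ext_eq_of_iso e,
    length_ext_quotient_eq hx, Module.length_eq_zero_iff]
  exact HasInjectiveDimensionLT.subsingleton _ (n + 1) _ (by omega) _

/-- Since `Ext^(j+1)(N/xN, R) = 0`, multiplication by `x` is onto on `Ext^j(N, R)`; Nakayama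
finishes. -/
theorem subsingleton_ext_of_isSMulRegular [IsNoetherianRing R] [IsLocalRing R]
    (hx : IsSMulRegular R x) (hxm : x ∈ IsLocalRing.maximalIdeal R) {n : ℕ}
    [HasInjectiveDimensionLE (ModuleCat.of (R ⧸ Ideal.span {x}) (R ⧸ Ideal.span {x})) n]
    (N : ModuleCat.{u} R) [Module.Finite R N] (hN : IsSMulRegular N x) {j : ℕ} (hj : n + 2 ≤ j) :
    Subsingleton (Abelian.Ext N (ModuleCat.of R R) j) := by
  have hS := hN.smulShortComplex_shortExact
  have : Subsingleton (Abelian.Ext (N.smulShortComplex x).X₃ (ModuleCat.of R R) (j + 1)) := by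
    refine subsingleton_ext_of_smul_eq_zero hx (n := n) _ (fun y => ?_) (by omega)
    obtain ⟨y, rfl⟩ := hS.moduleCat_surjective_g y
    have h := congrArg (fun φ => φ.hom y) (N.smulShortComplex x).zero
    rw [← map_smul]
    exact h
  by_contra hE
  rw [not_subsingleton_iff_nontrivial] at hE
  have hx' : x ∈ (Module.annihilator R (Abelian.Ext N (ModuleCat.of R R) j)).jacobson :=
    IsLocalRing.maximalIdeal_le_jacobson _ hxm
  refine Submodule.top_ne_pointwise_smul_of_mem_jacobson_annihilator hx' (top_le_iff.mp ?_).symm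
  intro y _
  obtain ⟨z, rfl⟩ := Abelian.Ext.contravariant_sequence_exact₁ hS (ModuleCat.of R R) y
    (add_comm 1 j) (Subsingleton.elim _ _)
  have h (z : Abelian.Ext N (ModuleCat.of R R) j) :
      (Abelian.Ext.mk₀ (x • 𝟙 N)).comp z (zero_add j) = x • z := by
    rw [Abelian.Ext.mk₀_smul, Abelian.Ext.smul_comp, Abelian.Ext.mk₀_id_comp]
  exact (h z) ▸ Submodule.smul_mem_pointwise_smul _ _ _ trivial

/-- Prime filtration: on `R ⧸ p`, the element `x` is either zero or regular. -/
theorem subsingleton_ext_of_finite [IsNoetherianRing R] [IsLocalRing R]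
    (hx : IsSMulRegular R x) (hxm : x ∈ IsLocalRing.maximalIdeal R) {n : ℕ}
    [HasInjectiveDimensionLE (ModuleCat.of (R ⧸ Ideal.span {x}) (R ⧸ Ideal.span {x})) n]
    (N : Type u) [AddCommGroup N] [Module R N] [hN : Module.Finite R N] {j : ℕ} (hj : n + 2 ≤ j) :
    Subsingleton (Abelian.Ext (ModuleCat.of R N) (ModuleCat.of R R) j) := by
  refine IsNoetherianRing.induction_on_isQuotientEquivQuotientPrime R hN
    (motive := fun N _ _ _ => Subsingleton (Abelian.Ext (ModuleCat.of R N) (ModuleCat.of R R) j))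
    (fun N _ _ _ _ => ?_) (fun N _ _ _ p e => ?_)
    (fun N₁ _ _ _ N₂ _ _ _ N₃ _ _ _ f g hf hg hfg h₁ h₃ => ?_)
  · exact subsingleton_ext_of_smul_eq_zero hx (n := n) _ (fun y => Subsingleton.elim (α := N) _ _) hj
  · by_cases hp : x ∈ p.asIdeal
    · refine subsingleton_ext_of_smul_eq_zero hx (n := n) _ (fun y => e.injective ?_) hj
      obtain ⟨r, hr⟩ := Ideal.Quotient.mk_surjective (e y)
      rw [map_smul, map_zero, ← hr]
      exact Ideal.Quotient.eq_zero_iff_mem.mpr (Ideal.mul_mem_right r _ hp)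
    · refine subsingleton_ext_of_isSMulRegular hx hxm (n := n) (ModuleCat.of R N) ?_ hj
      refine (e.isSMulRegular_congr x).mpr ?_
      rw [isSMulRegular_iff_right_eq_zero_of_smul]
      intro y hy
      obtain ⟨r, rfl⟩ := Ideal.Quotient.mk_surjective y
      exact Ideal.Quotient.eq_zero_iff_mem.mpr
        ((p.isPrime.mem_or_mem (Ideal.Quotient.eq_zero_iff_mem.mp hy)).resolve_left hp)
  · let S : ShortComplex (ModuleCat.{u} R) :=
      ModuleCat.shortComplexOfCompEqZero f g hfg.linearMap_comp_eq_zero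
    have hS : S.ShortExact := ModuleCat.shortComplex_shortExact S hfg hf hg
    refine ⟨fun y z => ?_⟩
    rw [← sub_eq_zero]
    obtain ⟨w, hw⟩ := Abelian.Ext.contravariant_sequence_exact₂ hS (ModuleCat.of R R) (y - z)
      (h₁.elim _ _)
    rw [← hw, h₃.elim w 0, Abelian.Ext.comp_zero]

theorem hasInjectiveDimensionLE_succ_of_quotient [IsNoetherianRing R] [IsLocalRing R]
    (hx : IsSMulRegular R x) (hxm : x ∈ IsLocalRing.maximalIdeal R) {n : ℕ}
    (h : HasInjectiveDimensionLE (ModuleCat.of (R ⧸ Ideal.span {x}) (R ⧸ Ideal.span {x})) n) :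
    HasInjectiveDimensionLE (ModuleCat.of R R) (n + 1) :=
  hasInjectiveDimensionLT_of_subsingleton_ext (n + 1) _ fun I =>
    subsingleton_ext_of_finite hx hxm (n := n) (R ⧸ I) le_rfl

theorem nonempty_iso_residueModule [IsLocalRing R] [IsLocalRing (R ⧸ Ideal.span {x})] :
    Nonempty ((quotientRestrictScalars x).obj (residueModule (R ⧸ Ideal.span {x})) ≅
      residueModule R) := by
  have : RingHomSurjective (Ideal.Quotient.mk (Ideal.span {x})) :=
    ⟨Ideal.Quotient.mk_surjective⟩
  let id' : (quotientRestrictScalars x).obj (residueModule (R ⧸ Ideal.span {x}))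
      →ₛₗ[Ideal.Quotient.mk (Ideal.span {x})] residueModule (R ⧸ Ideal.span {x}) :=
    { toFun := fun y => y
      map_add' := fun _ _ => rfl
      map_smul' := fun _ _ => rfl }
  have h := (length_eq_of_bijective id' Function.bijective_id).trans
    (length_residueField (R ⧸ Ideal.span {x}))
  obtain ⟨I, hI, ⟨e⟩⟩ := isSimpleModule_iff_quot_maximal.mp (Module.length_eq_one_iff.mp h)
  obtain rfl := IsLocalRing.eq_maximalIdeal hI
  exact ⟨e.toModuleIso⟩

open scoped Pointwise in
theorem isRegular_map_quotient {rs : List R} (h : RingTheory.Sequence.IsRegular R (x :: rs)) :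
    RingTheory.Sequence.IsRegular (R ⧸ Ideal.span {x})
      (rs.map (Ideal.Quotient.mk (Ideal.span {x}))) := by
  have h := ((RingTheory.Sequence.isRegular_cons_iff' R x rs).mp h).2
  have hI : x • (⊤ : Submodule R R) = Ideal.span {x} := by
    rw [← Submodule.ideal_span_singleton_smul, smul_eq_mul, Ideal.mul_top]
  let e : QuotSMulTop x R ≃ₗ[R ⧸ Ideal.span {x}] R ⧸ Ideal.span {x} :=
    (Submodule.quotEquivOfEq _ _ hI).extendScalarsOfSurjective Ideal.Quotient.mk_surjective
  exact (e.isRegular_congr _).mp h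

end RegularElement

/-! ### The Cohen–Macaulay case -/

section CohenMacaulay

/-- The Krull dimension is finite, so the supremum defining the depth is attained. -/
theorem exists_isRegular_of_isCohenMacaulay {R : Type u} [CommRing R] [IsNoetherianRing R]
    [IsLocalRing R] (h : IsCohenMacaulay R) :
    ∃ rs : List R, RingTheory.Sequence.IsRegular R rs ∧ ringKrullDim R = rs.length := by
  let P : List R → Prop := fun rs => (∀ r ∈ rs, r ∈ IsLocalRing.maximalIdeal R) ∧
    RingTheory.Sequence.IsRegular R rs
  have hdepth : depth R = ⨆ rs : {rs : List R // P rs}, (rs.1.length : ℕ∞) := iSup_subtype'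
  have : Nonempty {rs : List R // P rs} :=
    ⟨⟨[], by simp, RingTheory.Sequence.IsRegular.nil R R⟩⟩
  have hlt : depth R < ⊤ := by
    rw [← WithBot.coe_lt_coe]
    exact h.trans_lt ringKrullDim_lt_top
  rw [hdepth] at hlt
  obtain ⟨rs, hrs⟩ := ENat.exists_eq_iSup_of_lt_top hlt
  rw [← hdepth] at hrs
  exact ⟨rs.1, rs.2.2, by rw [← h, ← hrs]; rfl⟩

theorem injectiveDimension_of_length_ext_eq_one (d : ℕ) (R : Type u) [CommRing R]
    [IsNoetherianRing R] [IsLocalRing R] (n : ℕ) (rs : List R) (hd : rs.length = d)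
    (hrs : RingTheory.Sequence.IsRegular R rs) (hdim : ringKrullDim R = rs.length)
    (hn : Module.length R (Abelian.Ext (residueModule R) (ModuleCat.of R R) n) = 1) :
    n = d ∧ HasInjectiveDimensionLE (ModuleCat.of R R) d := by
  induction d generalizing R n rs with
  | zero =>
    obtain rfl := List.length_eq_zero_iff.mp hd
    have : Ring.KrullDimLE 0 R := (Ring.krullDimLE_iff).mpr hdim.le
    have : IsArtinianRing R := isArtinianRing_iff_isNoetherianRing_krullDimLE_zero.mpr
      ⟨inferInstance, this⟩
    obtain ⟨h0, hinj⟩ := injective_self_of_length_ext_eq_one hn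
    exact ⟨h0, inferInstanceAs (HasInjectiveDimensionLT (ModuleCat.of R R) 1)⟩
  | succ d ih =>
    obtain ⟨x, rs, rfl⟩ := List.exists_cons_of_length_eq_add_one hd
    have hx : IsSMulRegular R x := ((RingTheory.Sequence.isRegular_cons_iff R x rs).mp hrs).1
    have hxm : x ∈ IsLocalRing.maximalIdeal R := by
      simpa using fun hu => hrs.2 (by simp [Ideal.span_singleton_eq_top.mpr hu])
    have : Nontrivial (R ⧸ Ideal.span {x}) := Ideal.Quotient.nontrivial_iff.mpr
      (by rwa [Ne, Ideal.span_singleton_eq_top])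
    have : IsLocalRing (R ⧸ Ideal.span {x}) :=
      IsLocalRing.of_surjective' (Ideal.Quotient.mk (Ideal.span {x})) Ideal.Quotient.mk_surjective
    have hdim' : ringKrullDim (R ⧸ Ideal.span {x}) =
        (rs.map (Ideal.Quotient.mk (Ideal.span {x}))).length := by
      have h := ringKrullDim_quotient_span_singleton_succ_eq_ringKrullDim hx hxm
      rw [hdim, List.length_cons, Nat.cast_add, Nat.cast_one] at h
      rw [List.length_map]
      exact le_antisymm ((ENat.WithBot.add_le_add_natCast_right_iff (c := 1)).mp (by simpa using h.le))
        ((ENat.WithBot.add_le_add_natCast_right_iff (c := 1)).mp (by simpa using h.ge))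
    cases n with
    | zero =>
      rw [length_ext_zero_eq_length_linearMap] at hn
      -- In positive dimension `n = 0` cannot occur: `x` kills `k` but is regular on `R`.
      have : Subsingleton (residueModule R →ₗ[R] ModuleCat.of R R) :=
        IsSMulRegular.linearMap_subsingleton_of_mem_annihilator (r := x) hx
          (Module.mem_annihilator.mpr (smul_residueField_eq_zero hxm))
      rw [Module.length_eq_zero] at hn
      exact absurd hn zero_ne_one
    | succ n =>
      obtain ⟨e⟩ := nonempty_iso_residueModule (R := R) (x := x)
      rw [← length_ext_eq_of_iso e, length_ext_quotient_eq hx] at hn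
      obtain ⟨h1, h2⟩ := ih _ n _ (by simpa using hd) (isRegular_map_quotient hrs) hdim' hn
      exact ⟨by rw [h1], hasInjectiveDimensionLE_succ_of_quotient hx hxm h2⟩

end CohenMacaulay

end LocalAlgebra

theorem mainTheorem4 :
    (∀ (R : Type u) [CommRing R] [IsNoetherianRing R] [IsLocalRing R] (n : ℕ),
      LocalAlgebra.IsCohenMacaulay R → LocalAlgebra.bassNumber R n = 1 →
        LocalAlgebra.IsGorenstein R ∧ ringKrullDim R = n) ∧
    (∀ (R : Type u) [CommRing R] [IsArtinianRing R] [IsLocalRing R]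
      (M : Type u) [AddCommGroup M] [Module R M] [Module.Finite R M],
      ¬ Module.Free R M → Module.length R R ∣ Module.length R M →
        (∀ i : ℕ, 2 ≤ LocalAlgebra.bettiNumber R M i) ∧
        (Module.length R M = Module.length R R →
          LocalAlgebra.bettiNumber R M 0 ≤ LocalAlgebra.bettiNumber R M 1)) := by
  refine ⟨fun R _ _ _ n hR hn => ?_, fun R _ _ _ M _ _ _ hM hd =>
    ⟨LocalAlgebra.two_le_bettiNumber M hM hd, LocalAlgebra.bettiNumber_zero_le_bettiNumber_one M hM⟩⟩
  obtain ⟨rs, hrs, hdim⟩ := LocalAlgebra.exists_isRegular_of_isCohenMacaulay hR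
  obtain ⟨rfl, h⟩ := LocalAlgebra.injectiveDimension_of_length_ext_eq_one _ R n rs rfl hrs hdim
    (LocalAlgebra.length_ext_eq_one_of_bassNumber_eq_one hn)
  exact ⟨⟨_, h⟩, hdim⟩
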